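/- Let $M$ be a commutative cancellative monoid. A divisor theory of $M$ is a monoid homomorphism $\varphi\colon M\to D$ into a free abelian monoid $D$ such that (1) for all $a,b\in M$, if $\varphi(a)\mid\varphi(b)$ in $D$ then $a\mid b$ in $M$; and (2) every $\alpha\in D$ is the greatest common divisor of $\varphi(a_1),\dots,\varphi(a_k)$ for some $k\ge 1$ and $a_1,\dots,a_k\in M$. The monoid $M$ is called a Krull monoid if it has a divisor theory, and its class group is then $G=D/\varphi(M)$, the quotient of $D$ by the congruence under which $\alpha,\beta$ are equivalent if and only if $\alpha\,\varphi(a)=\beta\,\varphi(b)$ for some $a,b\in M$; by (2), it is an abelian group. For $x\in M$, let $\mathsf L(x)$ be the set of all integers $k\ge 0$ such that $x$ is a product of $k$ atoms (irreducible elements) of $M$, and let $\Delta(x)$ be the set of all differences $l-k$, where $k<l$ are elements of $\mathsf L(x)$ with no element of $\mathsf L(x)$ strictly between them. **Theorem.** Let $M$ be a Krull monoid whose class group $G$ is cyclic of order $n\ge 3$. If $x\in M$ and $n-2\in\Delta(x)$, then $\Delta(x)=\{n-2\}$. -/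

import Mathlib

namespace KrullMonoid

/-- The set of lengths `L(x)`: all `k` such that `x` is a product of `k` atoms
(irreducible elements), counted with multiplicity. -/
def setOfLengths {M : Type*} [CommMonoid M] (x : M) : Set ℕ :=
  {k | ∃ s : Multiset M, (∀ a ∈ s, Irreducible a) ∧ s.prod = x ∧ s.card = k}

/-- The delta set `Δ(x)`: all differences `l - k` of consecutive elements `k < l` of the
set of lengths of `x`. -/
def deltaSet {M : Type*} [CommMonoid M] (x : M) : Set ℕ :=
  {d | ∃ k ∈ setOfLengths x, ∃ l ∈ setOfLengths x,
    k < l ∧ (∀ m ∈ setOfLengths x, ¬ (k < m ∧ m < l)) ∧ d = l - k}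

/-- The free abelian monoid with basis `P`, written multiplicatively: finite multisets of
elements of `P`, with multiset sum as multiplication. -/
abbrev FreeAbMonoid (P : Type*) : Type _ := Multiplicative (Multiset P)

/-- `d` is a greatest common divisor of the set `S`. -/
def IsGcdOf {D : Type*} [CommMonoid D] (d : D) (S : Set D) : Prop :=
  (∀ s ∈ S, d ∣ s) ∧ ∀ e : D, (∀ s ∈ S, e ∣ s) → e ∣ d

/-- A divisor theory of the monoid `M` with set of prime divisors `P`: a homomorphism `φ` from `M`
to the free abelian monoid on `P` which reflects divisibility and such that every element of the
free abelian monoid is the greatest common divisor of finitely many values of `φ`.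
A Krull monoid is a (commutative cancellative) monoid that has a divisor theory. -/
structure DivisorTheory (M : Type*) [CancelCommMonoid M] (P : Type*) where
  φ : M →* FreeAbMonoid P
  dvd_of_map_dvd : ∀ a b : M, φ a ∣ φ b → a ∣ b
  exists_gcd : ∀ α : FreeAbMonoid P, ∃ s : Finset M, s.Nonempty ∧ IsGcdOf α (φ '' (s : Set M))

namespace DivisorTheory

variable {M : Type*} [CancelCommMonoid M] {P : Type*}

/-- The congruence on `D` modulo `φ(M)`: `α` and `β` are congruent when `α φ(a) = β φ(b)` for
some `a, b ∈ M`, i.e. when their quotient lies in the group generated by `φ(M)`. -/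
def con (T : DivisorTheory M P) : Con (FreeAbMonoid P) where
  r α β := ∃ a b : M, α * T.φ a = β * T.φ b
  iseqv :=
    { refl := fun _ => ⟨1, 1, rfl⟩
      symm := fun ⟨a, b, h⟩ => ⟨b, a, h.symm⟩
      trans := by
        rintro α β γ ⟨a, b, h⟩ ⟨c, d, h'⟩
        refine ⟨a * c, d * b, ?_⟩
        rw [map_mul, map_mul, ← mul_assoc, ← mul_assoc, h, ← h', mul_right_comm] }
  mul' := by
    rintro α β γ δ ⟨a, b, h⟩ ⟨c, d, h'⟩
    refine ⟨a * c, b * d, ?_⟩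
    rw [map_mul, map_mul, mul_mul_mul_comm, h, h', mul_mul_mul_comm]

/-- The class group `D / φ(M)`. -/
def ClassGroup (T : DivisorTheory M P) : Type _ := T.con.Quotient

instance (T : DivisorTheory M P) : CommMonoid T.ClassGroup :=
  inferInstanceAs (CommMonoid T.con.Quotient)

theorem exists_mul_eq_one (T : DivisorTheory M P) (c : T.ClassGroup) :
    ∃ d : T.ClassGroup, d * c = 1 := by
  obtain ⟨α, rfl⟩ := Con.mk'_surjective (c := T.con) c
  obtain ⟨s, ⟨a, ha⟩, hs, -⟩ := T.exists_gcd α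
  obtain ⟨β, hβ⟩ := hs (T.φ a) ⟨a, ha, rfl⟩
  refine ⟨T.con.mk' β, ?_⟩
  refine (Con.eq T.con).2 ⟨1, a, ?_⟩
  rw [map_one, mul_one, one_mul, hβ, mul_comm]

noncomputable instance (T : DivisorTheory M P) : CommGroup T.ClassGroup where
  inv c := (T.exists_mul_eq_one c).choose
  inv_mul_cancel c := (T.exists_mul_eq_one c).choose_spec

end DivisorTheory

end KrullMonoid

/-! Sending an element to the sequence of classes of its prime divisors turns atoms into minimal
zero-sum sequences over `G` and preserves sets of lengths of nonunits, so the question concerns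
zero-sum sequences over a group of order `n`.

Minimal zero-sum sequences have length at most `n`, hence any two factorizations of a sequence are
joined by a chain of steps, each exchanging at most `n` atoms for at most `n` others
(`reflTransGen_step`). A gap of size at least `n - 2` must be jumped by one such step. A single atom
cannot be refactored, so the step turns exactly two atoms into exactly `n`, and the gap is exactly
`n - 2`. Comparing lengths, the two atoms are `gⁿ` and `(-g)ⁿ` with `g` of order `n`
(`eq_pair_of_card`).

The gap also controls the other atoms. If one is `e a` with `e = j g` and `2 ≤ j ≤ n - 2`,
regrouping it with `gⁿ` and `(-g)ⁿ` lands inside the gap unless `a` splits into `j` pieces of sum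
`-g`. By symmetry `a` also splits into `n - j` pieces of sum `g`. This forces `|a| ≥ j (n - j) ≥ n`,
too long for a zero-sum free sequence (`eq_of_mem_of_gap`). So only `0`, `g`, `-g` occur, all
lengths are congruent modulo `n - 2`, and every gap is at least `n - 2`, hence equal to it. -/

namespace KrullMonoid

/-! ### Zero-sum sequences and their factorizations. -/

section ZeroSum

variable {G : Type*} [AddCommGroup G]

/-- A minimal zero-sum sequence, i.e. an atom of the block monoid over `G`. -/
def IsMinZeroSum (s : Multiset G) : Prop :=
  s ≠ 0 ∧ s.sum = 0 ∧ ∀ t ≤ s, t ≠ 0 → t.sum = 0 → t = s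

/-- A sequence without nonempty zero-sum subsequences. -/
def IsZeroSumFree (s : Multiset G) : Prop :=
  ∀ t ≤ s, t.sum = 0 → t = 0

/-- `z` is a factorization of the sequence `s` into minimal zero-sum sequences. -/
def IsFactorization (s : Multiset G) (z : Multiset (Multiset G)) : Prop :=
  (∀ a ∈ z, IsMinZeroSum a) ∧ z.sum = s

theorem IsZeroSumFree.mono {s t : Multiset G} (hs : IsZeroSumFree s) (h : t ≤ s) :
    IsZeroSumFree t := fun u hu => hs u (hu.trans h)

theorem IsMinZeroSum.isZeroSumFree {s t : Multiset G} (hs : IsMinZeroSum s) (h : t < s) :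
    IsZeroSumFree t := by
  intro u hu hu0
  by_contra hne
  have := hs.2.2 u (hu.trans h.le) hne hu0
  subst this
  exact absurd h (not_lt_of_ge hu)

theorem IsMinZeroSum.card_pos {s : Multiset G} (hs : IsMinZeroSum s) : 0 < s.card :=
  Multiset.card_pos.2 hs.1

theorem IsFactorization.add {s t : Multiset G} {z w : Multiset (Multiset G)}
    (hz : IsFactorization s z) (hw : IsFactorization t w) : IsFactorization (s + t) (z + w) := by
  refine ⟨fun a ha => ?_, by rw [Multiset.sum_add, hz.2, hw.2]⟩
  rcases Multiset.mem_add.1 ha with h | h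
  exacts [hz.1 a h, hw.1 a h]

theorem isFactorization_singleton {s : Multiset G} (hs : IsMinZeroSum s) :
    IsFactorization s {s} := by
  refine ⟨fun a ha => ?_, Multiset.sum_singleton s⟩
  rwa [Multiset.mem_singleton.1 ha]

theorem exists_isFactorization (s : Multiset G) (hs : s.sum = 0) :
    ∃ z, IsFactorization s z := by
  classical
  induction hk : s.card using Nat.strong_induction_on generalizing s with
  | _ k ih =>
  by_cases h0 : s = 0
  · exact ⟨0, by simp, by simp [h0]⟩
  by_cases hm : IsMinZeroSum s
  · exact ⟨{s}, isFactorization_singleton hm⟩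
  obtain ⟨t, hts, ht0, htsum, hne⟩ : ∃ t ≤ s, t ≠ 0 ∧ t.sum = 0 ∧ t ≠ s := by
    by_contra hcon
    push Not at hcon
    exact hm ⟨h0, hs, hcon⟩
  obtain ⟨u, rfl⟩ := Multiset.le_iff_exists_add.1 hts
  have hu : u ≠ 0 := by rintro rfl; simp at hne
  have h1 := Multiset.card_pos.2 ht0
  have h2 := Multiset.card_pos.2 hu
  rw [Multiset.card_add] at hk
  rw [Multiset.sum_add, htsum, zero_add] at hs
  obtain ⟨z, hz⟩ := ih t.card (by omega) t htsum rfl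
  obtain ⟨w, hw⟩ := ih u.card (by omega) u hs rfl
  exact ⟨z + w, hz.add hw⟩

theorem sum_eq_zero_of_forall {z : Multiset (Multiset G)} (hz : ∀ a ∈ z, IsMinZeroSum a) :
    z.sum.sum = 0 := by
  induction z using Multiset.induction_on with
  | empty => simp
  | cons a z ih =>
    rw [Multiset.sum_cons, Multiset.sum_add, (hz a (Multiset.mem_cons_self a z)).2.1,
      ih fun b hb => hz b (Multiset.mem_cons_of_mem hb), zero_add]

theorem card_mul_le_card_sum {α : Type*} (m : ℕ) (z : Multiset (Multiset α))
    (hz : ∀ a ∈ z, m ≤ a.card) : z.card * m ≤ z.sum.card := by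
  induction z using Multiset.induction_on with
  | empty => simp
  | cons a z ih =>
    have h1 := ih fun b hb => hz b (Multiset.mem_cons_of_mem hb)
    have h2 := hz a (Multiset.mem_cons_self a z)
    rw [Multiset.sum_cons, Multiset.card_add, Multiset.card_cons]
    linarith [add_mul z.card 1 m]

/-- Riesz refinement for multisets. -/
theorem exists_refinement {α : Type*} {a b r f : Multiset α} (h : a + b = r + f) :
    ∃ a₁ a₂ b₁ b₂, a = a₁ + a₂ ∧ b = b₁ + b₂ ∧ r = a₁ + b₁ ∧ f = a₂ + b₂ := by
  classical
  have hc : ∀ x, a.count x + b.count x = r.count x + f.count x := fun x => by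
    rw [← Multiset.count_add, ← Multiset.count_add, h]
  refine ⟨a ∩ r, a - r, r - a, f - (a - r), ?_, ?_, ?_, ?_⟩ <;>
  · ext x
    have := hc x
    simp only [Multiset.count_add, Multiset.count_inter, Multiset.count_sub]
    omega

/-- A multiset contained in a sum is contained in the sum of few of the terms. -/
theorem exists_le_sum_of_le_sum {α : Type*} (z : Multiset (Multiset α)) (u : Multiset α)
    (h : u ≤ z.sum) : ∃ v ≤ z, v.card ≤ u.card ∧ u ≤ v.sum := by
  induction z using Multiset.induction_on generalizing u with
  | empty => exact ⟨0, le_rfl, by simp, by simpa using h⟩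
  | cons a z ih =>
    obtain ⟨w, hw⟩ := Multiset.le_iff_exists_add.1 h
    rw [Multiset.sum_cons] at hw
    obtain ⟨a₁, a₂, b₁, b₂, ha, hb, rfl, -⟩ := exists_refinement hw
    obtain ⟨v, hv, hcard, hle⟩ := ih b₁ (hb ▸ Multiset.le_add_right b₁ b₂)
    by_cases h1 : a₁ = 0
    · subst h1
      exact ⟨v, hv.trans (Multiset.le_cons_self z a), by simpa using hcard, by simpa using hle⟩
    · refine ⟨a ::ₘ v, Multiset.cons_le_cons a hv, ?_, ?_⟩
      · have := Multiset.card_pos.2 h1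
        rw [Multiset.card_cons, Multiset.card_add]
        omega
      · rw [Multiset.sum_cons]
        exact add_le_add (ha ▸ Multiset.le_add_right a₁ a₂) hle

/-! ### The Davenport constant and the atoms of maximal length. -/

section Davenport

/-- The set of all sums of (possibly empty) subsequences. -/
def subsums (s : Multiset G) : Set G := {x | ∃ t ≤ s, t.sum = x}

theorem subsums_mono {s t : Multiset G} (h : s ≤ t) : subsums s ⊆ subsums t :=
  fun _ ⟨u, hu, hx⟩ => ⟨u, hu.trans h, hx⟩

variable [Finite G]

/-- Each further term `a` strictly enlarges the set of subsums: otherwise translation by `a` would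
permute this finite set, which contains `0`, and some subsequence would have sum `-a`. -/
theorem IsZeroSumFree.card_add_ncard_subsums_le {f e : Multiset G}
    (h : IsZeroSumFree (f + e)) : f.card + (subsums e).ncard ≤ (subsums (f + e)).ncard := by
  induction f using Multiset.induction_on with
  | empty => simp
  | cons a f ih =>
    rw [Multiset.cons_add] at h ⊢
    have h1 := ih (h.mono (Multiset.le_cons_self _ _))
    have hlt : (subsums (f + e)).ncard < (subsums (a ::ₘ (f + e))).ncard := by
      refine Set.ncard_lt_ncard ⟨subsums_mono (Multiset.le_cons_self _ _), fun hsub => ?_⟩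
        (Set.toFinite _)
      have himg : (fun x => a + x) '' subsums (f + e) = subsums (f + e) := by
        refine Set.eq_of_subset_of_ncard_le ?_ ?_ (Set.toFinite _)
        · rintro _ ⟨x, ⟨t, ht, rfl⟩, rfl⟩
          exact hsub ⟨a ::ₘ t, Multiset.cons_le_cons a ht, by simp⟩
        · rw [Set.ncard_image_of_injective _ (add_right_injective a)]
      have h0 : (0 : G) ∈ subsums (f + e) := ⟨0, Multiset.zero_le _, by simp⟩
      rw [← himg] at h0
      obtain ⟨_, ⟨t, ht, rfl⟩, hx⟩ := h0
      have := h (a ::ₘ t) (Multiset.cons_le_cons a ht) (by simpa using hx)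
      exact Multiset.cons_ne_zero this
    rw [Multiset.card_cons]
    omega

theorem IsZeroSumFree.card_lt {f : Multiset G} (h : IsZeroSumFree f) : f.card < Nat.card G := by
  have h1 := IsZeroSumFree.card_add_ncard_subsums_le (f := f) (e := 0) (by simpa using h)
  have h2 : 0 < (subsums (0 : Multiset G)).ncard :=
    (Set.ncard_pos (Set.toFinite _)).2 ⟨0, 0, le_rfl, by simp⟩
  have h3 := Set.ncard_le_card (subsums (f + 0))
  omega

theorem IsMinZeroSum.card_le {s : Multiset G} (h : IsMinZeroSum s) : s.card ≤ Nat.card G := by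
  obtain ⟨a, ha⟩ := Multiset.exists_mem_of_ne_zero h.1
  obtain ⟨t, rfl⟩ := Multiset.exists_cons_of_mem ha
  have := (h.isZeroSumFree (Multiset.lt_cons_self t a)).card_lt
  rw [Multiset.card_cons]
  omega

/-- Dropping one term of `w` leaves a zero-sum free sequence. If `a ≠ b`, the pair already has the
four subsums `0`, `a`, `b`, `a + b`, one more than its length allows for an atom of length `|G|`. -/
theorem IsMinZeroSum.eq_of_card_eq {a b : G} {w : Multiset G} (h : IsMinZeroSum (a ::ₘ b ::ₘ w))
    (hw : w ≠ 0) (hc : (a ::ₘ b ::ₘ w).card = Nat.card G) : a = b := by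
  by_contra hab
  obtain ⟨c, hcw⟩ := Multiset.exists_mem_of_ne_zero hw
  obtain ⟨f, rfl⟩ := Multiset.exists_cons_of_mem hcw
  have hperm : a ::ₘ b ::ₘ c ::ₘ f = c ::ₘ (f + {a, b}) := by
    rw [Multiset.cons_swap b c, Multiset.cons_swap a c, Multiset.insert_eq_cons, add_comm,
      Multiset.cons_add, Multiset.singleton_add]
  have hfree : IsZeroSumFree (f + {a, b}) :=
    h.isZeroSumFree (by rw [hperm]; exact Multiset.lt_cons_self _ _)
  have h1 := hfree.card_add_ncard_subsums_le
  have h2 := Set.ncard_le_card (subsums (f + {a, b}))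
  have ha : a ≠ 0 := fun h0 => by
    have := hfree {a} (Multiset.singleton_le.2 (by simp)) (by simpa using h0)
    simp at this
  have hb : b ≠ 0 := fun h0 => by
    have := hfree {b} (Multiset.singleton_le.2 (by simp)) (by simpa using h0)
    simp at this
  have hs : a + b ≠ 0 := fun h0 => by
    have := hfree {a, b} (Multiset.le_add_left _ _) (by simpa using h0)
    simp at this
  have h3 : 4 ≤ (subsums ({a, b} : Multiset G)).ncard := by
    classical
    have hcard : (({0, a, b, a + b} : Finset G) : Set G).ncard = 4 := by
      rw [Set.ncard_coe_finset, Finset.card_insert_of_notMem, Finset.card_insert_of_notMem,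
        Finset.card_insert_of_notMem, Finset.card_singleton]
      · simpa using ha
      · simpa using ⟨hab, hb⟩
      · simpa [eq_comm] using ⟨ha, hb, hs⟩
    rw [← hcard]
    refine Set.ncard_le_ncard ?_ (Set.toFinite _)
    intro x hx
    simp only [Finset.coe_insert, Finset.coe_singleton, Set.mem_insert_iff,
      Set.mem_singleton_iff] at hx
    rcases hx with rfl | rfl | rfl | rfl
    · exact ⟨0, Multiset.zero_le _, by simp⟩
    · exact ⟨{x}, Multiset.singleton_le.2 (by simp), by simp⟩
    · exact ⟨{x}, Multiset.singleton_le.2 (by simp), by simp⟩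
    · exact ⟨{a, b}, le_rfl, by simp⟩
  simp only [Multiset.card_cons] at hc
  omega

theorem IsMinZeroSum.exists_eq_replicate {s : Multiset G} (h : IsMinZeroSum s)
    (hn : 3 ≤ Nat.card G) (hc : s.card = Nat.card G) :
    ∃ g, s = Multiset.replicate (Nat.card G) g ∧ addOrderOf g = Nat.card G := by
  obtain ⟨g, hg⟩ := Multiset.exists_mem_of_ne_zero h.1
  have hs : s = Multiset.replicate (Nat.card G) g := by
    rw [Multiset.eq_replicate]
    refine ⟨hc, fun b hb => ?_⟩
    obtain ⟨t, rfl⟩ := Multiset.exists_cons_of_mem hg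
    rcases Multiset.mem_cons.1 hb with rfl | hb
    · rfl
    obtain ⟨w, rfl⟩ := Multiset.exists_cons_of_mem hb
    refine (h.eq_of_card_eq ?_ hc).symm
    rintro rfl
    simp only [Multiset.card_cons, Multiset.card_zero] at hc
    omega
  refine ⟨g, hs, ?_⟩
  have hle : addOrderOf g ≤ Nat.card G := addOrderOf_le_card
  have hpos : 0 < addOrderOf g := addOrderOf_pos g
  have := h.2.2 (Multiset.replicate (addOrderOf g) g)
    (by rw [hs]; exact (Multiset.replicate_le_replicate g).2 hle)
    (fun h0 => by
      have := congrArg Multiset.card h0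
      simp only [Multiset.card_replicate, Multiset.card_zero] at this
      omega)
    (by rw [Multiset.sum_replicate, addOrderOf_nsmul_eq_zero])
  rw [← hc, ← this, Multiset.card_replicate]

end Davenport

/-! ### Chains of factorizations and the catenary degree. -/

/-- Replacing at most `n` atoms in a factorization by at most `n` others. -/
def Step (n : ℕ) (z z' : Multiset (Multiset G)) : Prop :=
  ∃ c p q, z = c + p ∧ z' = c + q ∧ (∀ a ∈ p, IsMinZeroSum a) ∧ (∀ a ∈ q, IsMinZeroSum a) ∧
    p.sum = q.sum ∧ p.card ≤ n ∧ q.card ≤ n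

theorem Step.symm {n : ℕ} {z z' : Multiset (Multiset G)} (h : Step n z z') : Step n z' z := by
  obtain ⟨c, p, q, hz, hz', hp, hq, hs, h1, h2⟩ := h
  exact ⟨c, q, p, hz', hz, hq, hp, hs.symm, h2, h1⟩

theorem Step.add_left {n : ℕ} {z z' : Multiset (Multiset G)} (d : Multiset (Multiset G))
    (h : Step n z z') : Step n (d + z) (d + z') := by
  obtain ⟨c, p, q, rfl, rfl, h⟩ := h
  exact ⟨d + c, p, q, (add_assoc _ _ _).symm, (add_assoc _ _ _).symm, h⟩

theorem Step.isFactorization {n : ℕ} {z z' : Multiset (Multiset G)} {s : Multiset G}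
    (h : Step n z z') (hz : IsFactorization s z) : IsFactorization s z' := by
  obtain ⟨c, p, q, rfl, rfl, hp, hq, hs, -⟩ := h
  refine ⟨fun a ha => ?_, by rw [Multiset.sum_add, ← hs, ← Multiset.sum_add, hz.2]⟩
  rcases Multiset.mem_add.1 ha with h | h
  exacts [hz.1 a (Multiset.mem_add.2 (Or.inl h)), hq a h]

open Relation in
theorem Step.reflTransGen_add_left {n : ℕ} {z z' : Multiset (Multiset G)}
    (d : Multiset (Multiset G)) (h : ReflTransGen (Step n) z z') :
    ReflTransGen (Step n) (d + z) (d + z') :=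
  h.lift (d + ·) fun _ _ hab => Step.add_left d hab

theorem IsFactorization.eq_zero_iff {s : Multiset G} {z : Multiset (Multiset G)}
    (hz : IsFactorization s z) : z = 0 ↔ s = 0 := by
  refine ⟨fun h => by rw [← hz.2, h, Multiset.sum_zero], fun h => ?_⟩
  by_contra hne
  obtain ⟨a, ha⟩ := Multiset.exists_mem_of_ne_zero hne
  have h1 : a ≤ z.sum := Multiset.le_sum_of_mem ha
  rw [hz.2, h] at h1
  exact (hz.1 a ha).1 (le_antisymm h1 (Multiset.zero_le a))

open Relation in
/-- The catenary degree of the block monoid is at most the maximal length of an atom. -/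
theorem reflTransGen_step {n : ℕ} (hn : ∀ a : Multiset G, IsMinZeroSum a → a.card ≤ n)
    (s : Multiset G) (z z' : Multiset (Multiset G))
    (hz : IsFactorization s z) (hz' : IsFactorization s z') :
    ReflTransGen (Step n) z z' := by
  induction hk : s.card using Nat.strong_induction_on generalizing s z z' with
  | _ k ih =>
  -- An atom `u` of `z` divides the product of a part `v` of `z'` with at most `n` atoms. As `z'`
  -- has more than `n`, `v.sum` is shorter than `s`, so induction leads from `v` to a factorization
  -- containing `u`; what remains after removing `u` is again shorter than `s`.
  have key : ∀ z z', IsFactorization s z → IsFactorization s z' → n < z'.card →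
      ReflTransGen (Step n) z' z := by
    intro z z' hz hz' hlt
    have hz'0 : z' ≠ 0 := by rintro rfl; simp at hlt
    have hz0 : z ≠ 0 := fun h => hz'0 (hz'.eq_zero_iff.2 (hz.eq_zero_iff.1 h))
    obtain ⟨u, hu⟩ := Multiset.exists_mem_of_ne_zero hz0
    obtain ⟨z₁, rfl⟩ := Multiset.exists_cons_of_mem hu
    have hua := hz.1 u hu
    have hule : u ≤ z'.sum := by
      rw [hz'.2, ← hz.2, Multiset.sum_cons]
      exact Multiset.le_add_right _ _
    obtain ⟨v, hv, hvc, huv⟩ := exists_le_sum_of_le_sum z' u hule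
    obtain ⟨w, rfl⟩ := Multiset.le_iff_exists_add.1 hv
    have hvn := hvc.trans (hn u hua)
    have hw0 : w ≠ 0 := by
      rintro rfl
      rw [add_zero] at hlt
      omega
    have hva : ∀ a ∈ v, IsMinZeroSum a := fun a ha => hz'.1 a (Multiset.mem_add.2 (Or.inl ha))
    have hwa : ∀ a ∈ w, IsMinZeroSum a := fun a ha => hz'.1 a (Multiset.mem_add.2 (Or.inr ha))
    obtain ⟨r, hr⟩ := Multiset.le_iff_exists_add.1 huv
    have hr0 : r.sum = 0 := by
      have := sum_eq_zero_of_forall hva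
      rwa [hr, Multiset.sum_add, hua.2.1, zero_add] at this
    obtain ⟨y, hy⟩ := exists_isFactorization r hr0
    have hssum : v.sum + w.sum = s := by rw [← Multiset.sum_add, hz'.2]
    have hwpos : 0 < w.sum.card := by
      refine Multiset.card_pos.2 fun h => hw0 ?_
      exact (IsFactorization.eq_zero_iff ⟨hwa, rfl⟩).2 h
    have hcard : v.sum.card + w.sum.card = k := by rw [← Multiset.card_add, hssum, hk]
    have h1 : ReflTransGen (Step n) v (u ::ₘ y) := by
      refine ih v.sum.card (by omega) v.sum v (u ::ₘ y) ⟨hva, rfl⟩ ?_ rfl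
      have := (isFactorization_singleton hua).add hy
      rwa [Multiset.singleton_add, ← hr] at this
    have hrs : r + w.sum = z₁.sum := by
      have h2 := hz.2
      rw [Multiset.sum_cons, ← hssum, hr, add_assoc] at h2
      exact (add_left_cancel h2).symm
    have h2 : ReflTransGen (Step n) (y + w) z₁ := by
      refine ih (r + w.sum).card ?_ (r + w.sum) (y + w) z₁ (hy.add ⟨hwa, rfl⟩)
        ⟨fun a ha => hz.1 a (Multiset.mem_cons_of_mem ha), hrs.symm⟩ rfl
      have := hua.card_pos
      rw [hr, Multiset.card_add] at hcard
      rw [Multiset.card_add]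
      omega
    have h3 := Step.reflTransGen_add_left w h1
    have h4 := Step.reflTransGen_add_left {u} h2
    rw [add_comm w v] at h3
    have e : w + u ::ₘ y = {u} + (y + w) := by
      rw [Multiset.singleton_add, Multiset.add_cons, add_comm]
    rw [e] at h3
    rw [Multiset.singleton_add u z₁] at h4
    exact h3.trans h4
  have : Std.Symm (Step n : Multiset (Multiset G) → _) := ⟨fun _ _ h => h.symm⟩
  rcases lt_or_ge n z'.card with h | h
  · exact Std.Symm.symm _ _ (key z z' hz hz' h)
  rcases lt_or_ge n z.card with h' | h'
  · exact key z' z hz' hz h'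
  · exact ReflTransGen.single
      ⟨0, z, z', (zero_add _).symm, (zero_add _).symm, hz.1, hz'.1, hz.2.trans hz'.2.symm, h', h⟩

open Relation in
-- No factorization along the chain has length strictly inside the gap, so the chain has to cross it
-- in one step.
theorem exists_step_of_gap {n k l : ℕ} {s : Multiset G} {z z' : Multiset (Multiset G)}
    (hz : IsFactorization s z) (h : ReflTransGen (Step n) z z')
    (hgap : ∀ y, IsFactorization s y → ¬ (k < y.card ∧ y.card < l))
    (hk : z.card ≤ k) (hl : l ≤ z'.card) (hkl : k < l) :
    ∃ y y', IsFactorization s y ∧ Step n y y' ∧ y.card ≤ k ∧ l ≤ y'.card := by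
  induction h using ReflTransGen.head_induction_on with
  | refl => omega
  | head hstep _ ih =>
    rename_i a b _
    have hb := hstep.isFactorization hz
    by_cases hbk : b.card ≤ k
    · exact ih hb hbk
    · have := hgap b hb
      exact ⟨a, b, hz, hstep, hk, by omega⟩

end ZeroSum

/-! ### Consequences of a large gap. -/

section Gap

variable {G : Type*} [AddCommGroup G]

/-- Every atom uses at least one term of `r`, since none fits inside the zero-sum free `f`. -/
theorem card_le_card_of_sum_eq_add {f r : Multiset G} {z : Multiset (Multiset G)}
    (hz : IsFactorization (r + f) z) (hf : IsZeroSumFree f) : z.card ≤ r.card := by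
  obtain ⟨hz, hsum⟩ := hz
  induction z using Multiset.induction_on generalizing f r with
  | empty => simp
  | cons a z ih =>
    have ha := hz a (Multiset.mem_cons_self a z)
    rw [Multiset.sum_cons] at hsum
    obtain ⟨a₁, a₂, b₁, b₂, rfl, hb, rfl, rfl⟩ := exists_refinement hsum
    have h1 := ih (hf.mono (Multiset.le_add_left b₂ a₂))
      (fun b hb => hz b (Multiset.mem_cons_of_mem hb)) hb
    have h2 : a₁ ≠ 0 := by
      rintro rfl
      rw [zero_add] at ha
      exact ha.1 (hf a₂ (Multiset.le_add_right _ _) ha.2.1)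
    have := Multiset.card_pos.2 h2
    rw [Multiset.card_cons, Multiset.card_add]
    omega

/-- If replacing a sum by copies of `g` gives as many atoms as possible, the remaining sequence
splits into sequences of sum `-g`. -/
theorem exists_split_of_card_eq {f : Multiset G} {g : G} {j : ℕ} {z : Multiset (Multiset G)}
    (hz : IsFactorization (Multiset.replicate j g + f) z) (hf : IsZeroSumFree f)
    (hj : z.card = j) :
    ∃ y : Multiset (Multiset G), y.card = j ∧ y.sum = f ∧ ∀ b ∈ y, b.sum = -g := by
  obtain ⟨hz, hsum⟩ := hz
  induction z using Multiset.induction_on generalizing f j with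
  | empty =>
    rw [Multiset.card_zero] at hj
    subst hj
    exact ⟨0, rfl, by simpa using hsum, by simp⟩
  | cons a z ih =>
    have ha := hz a (Multiset.mem_cons_self a z)
    rw [Multiset.sum_cons] at hsum
    obtain ⟨a₁, a₂, b₁, b₂, rfl, hb, hr, rfl⟩ := exists_refinement hsum
    have hz' : ∀ b ∈ z, IsMinZeroSum b := fun b hb => hz b (Multiset.mem_cons_of_mem hb)
    have hf' := hf.mono (Multiset.le_add_left b₂ a₂)
    have h1 := card_le_card_of_sum_eq_add ⟨hz', hb⟩ hf'
    have h2 : a₁ ≠ 0 := by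
      rintro rfl
      rw [zero_add] at ha
      exact ha.1 (hf a₂ (Multiset.le_add_right _ _) ha.2.1)
    have h3 := Multiset.card_pos.2 h2
    have h4 : a₁.card + b₁.card = j := by
      rw [← Multiset.card_add, ← hr, Multiset.card_replicate]
    rw [Multiset.card_cons] at hj
    have hmem : ∀ x ∈ a₁ + b₁, x = g := fun x hx => Multiset.eq_of_mem_replicate (hr ▸ hx)
    -- With `j` atoms and `j` copies of `g`, each atom takes exactly one copy.
    have hb₁ : b₁ = Multiset.replicate (j - 1) g := Multiset.eq_replicate.2
      ⟨by omega, fun x hx => hmem x (Multiset.mem_add.2 (Or.inr hx))⟩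
    have ha₁ : a₁ = Multiset.replicate 1 g := Multiset.eq_replicate.2
      ⟨by omega, fun x hx => hmem x (Multiset.mem_add.2 (Or.inl hx))⟩
    rw [hb₁] at hb
    obtain ⟨y, hy, hys, hyb⟩ := ih hf' (by omega) hz' hb
    refine ⟨a₂ ::ₘ y, by rw [Multiset.card_cons]; omega, by rw [Multiset.sum_cons, hys], ?_⟩
    intro b hb
    rcases Multiset.mem_cons.1 hb with rfl | hb
    · have := ha.2.1
      rw [ha₁, Multiset.sum_add, Multiset.sum_replicate, one_smul] at this
      exact (neg_eq_of_add_eq_zero_right this).symm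
    · exact hyb b hb

/-- A zero-sum free sequence that splits into `j` sequences of sum `-g` and into `m` sequences of
sum `g` has length at least `m * j`. -/
theorem mul_le_card_of_splits {f : Multiset G} {g : G} (hg : g ≠ 0) (hf : IsZeroSumFree f)
    {y w : Multiset (Multiset G)} (hy : y.sum = f) (hyg : ∀ b ∈ y, b.sum = -g)
    (hw : w.sum = f) (hwg : ∀ b ∈ w, b.sum = g) : w.card * y.card ≤ f.card := by
  rw [← hw]
  refine card_mul_le_card_sum _ _ fun c hc => ?_
  by_contra! hlt
  -- A piece `c` of sum `g` shorter than `y.card` meets too few pieces of `y`. Some piece `b` of sum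
  -- `-g` is disjoint from it, and `c + b` is a zero-sum subsequence of `f`.
  obtain ⟨v, hv, hvc, hcv⟩ := exists_le_sum_of_le_sum y c
    (by rw [hy, ← hw]; exact Multiset.le_sum_of_mem hc)
  obtain ⟨t, rfl⟩ := Multiset.le_iff_exists_add.1 hv
  have ht : t ≠ 0 := by
    rintro rfl
    rw [add_zero] at hlt
    omega
  obtain ⟨b, hb⟩ := Multiset.exists_mem_of_ne_zero ht
  have hle : c + b ≤ f := by
    rw [← hy, Multiset.sum_add]
    exact add_le_add hcv (Multiset.le_sum_of_mem hb)
  have h0 := hf (c + b) hle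
    (by rw [Multiset.sum_add, hwg c hc, hyg b (Multiset.mem_add.2 (Or.inr hb)), add_neg_cancel])
  have hc0 : c = 0 := (add_eq_zero.1 h0).1
  have := hwg c hc
  rw [hc0, Multiset.sum_zero] at this
  exact hg this.symm

variable {n : ℕ}

theorem isMinZeroSum_replicate {g : G} (hn : 0 < n) (hg : addOrderOf g = n) :
    IsMinZeroSum (Multiset.replicate n g) := by
  refine ⟨fun h => ?_, ?_, fun t ht ht0 hts => ?_⟩
  · have := congrArg Multiset.card h
    rw [Multiset.card_replicate, Multiset.card_zero] at this
    omega
  · rw [Multiset.sum_replicate, ← hg, addOrderOf_nsmul_eq_zero]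
  · obtain ⟨m, hm, rfl⟩ := Multiset.le_replicate_iff.1 ht
    rw [Multiset.sum_replicate] at hts
    have h1 := addOrderOf_dvd_of_nsmul_eq_zero hts
    have h2 : 0 < m := by
      rcases Nat.eq_zero_or_pos m with rfl | h
      · exact absurd rfl ht0
      · exact h
    have := Nat.le_of_dvd h2 h1
    have : m = n := by omega
    rw [this]

theorem isZeroSumFree_replicate {g : G} {j : ℕ} (hg : addOrderOf g = n) (hj : j < n) :
    IsZeroSumFree (Multiset.replicate j g) :=
  (isMinZeroSum_replicate (by omega) hg).isZeroSumFree
    (lt_of_le_of_ne ((Multiset.replicate_le_replicate g).2 hj.le) fun h => by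
      have := congrArg Multiset.card h
      simp only [Multiset.card_replicate] at this
      omega)

theorem isMinZeroSum_pair {g : G} (hg : g ≠ 0) : IsMinZeroSum ({g, -g} : Multiset G) := by
  refine ⟨by simp, by simp, fun t ht ht0 hts => ?_⟩
  obtain ⟨u, hu⟩ := Multiset.le_iff_exists_add.1 ht
  have hc := congrArg Multiset.card hu
  have hpos := Multiset.card_pos.2 ht0
  simp only [Multiset.insert_eq_cons, Multiset.card_cons, Multiset.card_singleton,
    Multiset.card_add] at hc
  by_cases h1 : t.card = 1
  · obtain ⟨x, rfl⟩ := Multiset.card_eq_one.1 h1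
    rw [Multiset.sum_singleton] at hts
    subst hts
    have := Multiset.singleton_le.1 ht
    simp [eq_comm, hg] at this
  · have : u = 0 := Multiset.card_eq_zero.1 (by omega)
    rw [hu, this, add_zero]

/-- If `c + {gⁿ, (-g)ⁿ}` has length `k` and no factorization has length strictly between `k` and
`k + n - 2`, then an element `j • g` with `2 ≤ j ≤ n - 2` of an atom in `c` leaves a sequence that
splits into `j` sequences of sum `-g`. -/
theorem exists_split_of_gap {g : G} (hg : addOrderOf g = n) {s a : Multiset G} {e : G}
    {c : Multiset (Multiset G)} {j : ℕ}
    (hs : IsFactorization s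
      ((e ::ₘ a) ::ₘ c + {Multiset.replicate n g, Multiset.replicate n (-g)}))
    (hgap : ∀ y, IsFactorization s y → ¬ (c.card + 3 < y.card ∧ y.card < c.card + n + 1))
    (he : e = j • g) (h2 : 2 ≤ j) (hj : j + 2 ≤ n) :
    ∃ y : Multiset (Multiset G), y.card = j ∧ y.sum = a ∧ ∀ b ∈ y, b.sum = -g := by
  have hg0 : g ≠ 0 := by
    rintro rfl
    rw [addOrderOf_zero] at hg
    omega
  have hea : IsMinZeroSum (e ::ₘ a) := hs.1 _ (by simp)
  have hafree : IsZeroSumFree a := hea.isZeroSumFree (Multiset.lt_cons_self a e)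
  have hasum : a.sum = -(j • g) := by
    have := hea.2.1
    rw [Multiset.sum_cons, he] at this
    exact (neg_eq_of_add_eq_zero_right this).symm
  -- Regroup `(e a) gⁿ (-g)ⁿ` as `e (-g)ʲ`, `gʲ a` and `n - j` pairs `g (-g)`. The first is one atom
  -- and the second has between `1` and `j` atoms.
  obtain ⟨z₁, hz₁⟩ := exists_isFactorization (({e} : Multiset G) + Multiset.replicate j (-g))
    (by simp [he])
  obtain ⟨z₂, hz₂⟩ := exists_isFactorization (Multiset.replicate j g + a) (by simp [hasum])
  have hc₁ := card_le_card_of_sum_eq_add hz₁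
    (isZeroSumFree_replicate (by rw [addOrderOf_neg, hg]) (by omega))
  rw [Multiset.card_singleton] at hc₁
  have hc₂ := card_le_card_of_sum_eq_add hz₂ hafree
  rw [Multiset.card_replicate] at hc₂
  have hp₁ : 0 < z₁.card := Multiset.card_pos.2 fun h => by
    have := hz₁.eq_zero_iff.1 h
    simp at this
  have hp₂ : 0 < z₂.card := Multiset.card_pos.2 fun h => by
    have := congrArg Multiset.card (hz₂.eq_zero_iff.1 h)
    rw [Multiset.card_add, Multiset.card_replicate, Multiset.card_zero] at this
    omega
  refine exists_split_of_card_eq hz₂ hafree ?_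
  -- With fewer than `j` atoms in `z₂`, the new length lies between `c.card + 2 + (n - j) ≥ c.card +
  -- 4` and `c.card + n`, inside the gap.
  by_contra hne
  have hpairs : IsFactorization (Multiset.replicate (n - j) g + Multiset.replicate (n - j) (-g))
      (Multiset.replicate (n - j) {g, -g}) := by
    refine ⟨fun b hb => ?_, ?_⟩
    · rw [Multiset.eq_of_mem_replicate hb]
      exact isMinZeroSum_pair hg0
    · rw [Multiset.sum_replicate, Multiset.insert_eq_cons, ← Multiset.singleton_add, nsmul_add,
        Multiset.nsmul_singleton, Multiset.nsmul_singleton]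
  have hc : IsFactorization c.sum c := ⟨fun b hb => hs.1 b (by simp [hb]), rfl⟩
  have hnew := ((hc.add hz₁).add hz₂).add hpairs
  have hrep : ∀ x : G, Multiset.replicate n x
      = Multiset.replicate j x + Multiset.replicate (n - j) x := fun x => by
    rw [← Multiset.replicate_add]
    congr 1
    omega
  have hsum : c.sum + ({e} + Multiset.replicate j (-g)) + (Multiset.replicate j g + a)
      + (Multiset.replicate (n - j) g + Multiset.replicate (n - j) (-g)) = s := by
    rw [← hs.2, Multiset.insert_eq_cons, Multiset.sum_add, Multiset.sum_cons, Multiset.sum_cons,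
      Multiset.sum_singleton, hrep g, hrep (-g), ← Multiset.singleton_add]
    abel
  rw [hsum] at hnew
  refine hgap _ hnew ?_
  simp only [Multiset.card_add, Multiset.card_replicate]
  omega

theorem ne_neg_of_addOrderOf_eq {g : G} (hn : 3 ≤ n) (hg : addOrderOf g = n) : g ≠ -g := by
  intro h
  have h2 : 2 • g = 0 := by
    rw [two_nsmul]
    nth_rewrite 2 [h]
    exact add_neg_cancel g
  have := Nat.le_of_dvd two_pos (addOrderOf_dvd_of_nsmul_eq_zero h2)
  omega

theorem eq_of_mem_of_gap [Finite G] (hn : 3 ≤ n) (hcard : Nat.card G = n) {g : G}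
    (hg : addOrderOf g = n) {s : Multiset G} {c : Multiset (Multiset G)}
    (hs : IsFactorization s (c + {Multiset.replicate n g, Multiset.replicate n (-g)}))
    (hgap : ∀ y, IsFactorization s y → ¬ (c.card + 2 < y.card ∧ y.card < c.card + n))
    {e : G} (he : e ∈ s) : e = 0 ∨ e = g ∨ e = -g := by
  classical
  have hg0 : g ≠ 0 := by
    rintro rfl
    rw [addOrderOf_zero] at hg
    omega
  have htop : AddSubgroup.zmultiples g = ⊤ := by
    refine AddSubgroup.eq_top_of_card_eq _ ?_
    rw [Nat.card_zmultiples, hg, hcard]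
  have heg : e ∈ AddSubgroup.zmultiples g := htop ▸ AddSubgroup.mem_top e
  rw [← mem_multiples_iff_mem_zmultiples,
    mem_multiples_iff_mem_range_addOrderOf, Finset.mem_image] at heg
  obtain ⟨j, hj, rfl⟩ := heg
  rw [Finset.mem_range, hg] at hj
  rw [← hs.2, Multiset.sum_add, Multiset.mem_add] at he
  by_contra! hcon
  obtain ⟨h0, h1, h2⟩ := hcon
  rcases he with he | he
  swap
  · simp only [Multiset.insert_eq_cons, Multiset.sum_cons, Multiset.sum_singleton,
      Multiset.mem_add] at he
    rcases he with he | he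
    exacts [h1 (Multiset.eq_of_mem_replicate he), h2 (Multiset.eq_of_mem_replicate he)]
  have hng : n • g = 0 := by rw [← hg, addOrderOf_nsmul_eq_zero]
  have hj0 : j ≠ 0 := by rintro rfl; simp at h0
  have hj1 : j ≠ 1 := by rintro rfl; simp at h1
  have hneg : j • g = (n - j) • (-g) := by
    rw [neg_nsmul, eq_neg_iff_add_eq_zero, ← add_nsmul, show j + (n - j) = n by omega, hng]
  have hj2 : j ≠ n - 1 := by
    rintro rfl
    rw [show n - (n - 1) = 1 by omega, one_nsmul] at hneg
    exact h2 hneg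
  obtain ⟨b, hb, heb⟩ : ∃ b ∈ c, j • g ∈ b := by
    rw [← Multiset.mem_join]
    exact he
  obtain ⟨a, rfl⟩ := Multiset.exists_cons_of_mem heb
  obtain ⟨d, rfl⟩ := Multiset.exists_cons_of_mem hb
  have hgap' : ∀ y, IsFactorization s y → ¬ (d.card + 3 < y.card ∧ y.card < d.card + n + 1) := by
    intro y hy hlt
    refine hgap y hy ?_
    rw [Multiset.card_cons]
    omega
  obtain ⟨y, hyc, hys, hyb⟩ := exists_split_of_gap hg hs hgap' rfl (by omega) (by omega)
  -- The situation is symmetric under `g ↦ -g`, with `j` replaced by `n - j`.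
  have hs' : IsFactorization s ((j • g ::ₘ a) ::ₘ d
      + {Multiset.replicate n (-g), Multiset.replicate n (- -g)}) := by
    rw [neg_neg, Multiset.pair_comm]
    exact hs
  obtain ⟨w, hwc, hws, hwb⟩ := exists_split_of_gap (by rw [addOrderOf_neg, hg]) hs' hgap' hneg
    (by omega) (by omega)
  have hafree : IsZeroSumFree a :=
    (hs.1 (j • g ::ₘ a) (by simp)).isZeroSumFree (Multiset.lt_cons_self a _)
  have hle := mul_le_card_of_splits hg0 hafree hys hyb hws
    (fun b hb => by rw [hwb b hb, neg_neg])
  have hlt := hafree.card_lt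
  rw [hwc, hyc] at hle
  rw [hcard] at hlt
  -- Now `(n - j) j ≤ |a| < n`, whereas `(p + 2)(q + 2) ≥ p + q + 4 = n`.
  obtain ⟨m, rfl⟩ : ∃ m, n = j + m := ⟨n - j, by omega⟩
  rw [Nat.add_sub_cancel_left] at hle
  obtain ⟨p, rfl⟩ : ∃ p, j = p + 2 := ⟨j - 2, by omega⟩
  obtain ⟨q, rfl⟩ : ∃ q, m = q + 2 := ⟨m - 2, by omega⟩
  nlinarith [Nat.zero_le (p * q)]

/-! ### Sequences with terms in `{0, g, -g}`. -/

theorem IsMinZeroSum.eq_of_forall_mem {g : G} (hn : 3 ≤ n) (hg : addOrderOf g = n)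
    {a : Multiset G} (ha : IsMinZeroSum a) (hmem : ∀ e ∈ a, e = 0 ∨ e = g ∨ e = -g) :
    a = {0} ∨ a = {g, -g} ∨ a = Multiset.replicate n g ∨ a = Multiset.replicate n (-g) := by
  have hgg := ne_neg_of_addOrderOf_eq hn hg
  by_cases h0 : (0 : G) ∈ a
  · exact Or.inl (ha.2.2 {0} (Multiset.singleton_le.2 h0) (by simp) (by simp)).symm
  refine Or.inr ?_
  have key : ∀ h : G, addOrderOf h = n → (∀ e ∈ a, e = h) → a = Multiset.replicate n h := by
    intro h hh hall
    have hr := Multiset.eq_replicate_card.2 hall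
    have hs := ha.2.1
    rw [hr, Multiset.sum_replicate] at hs
    have hle := Nat.le_of_dvd ha.card_pos (hh ▸ addOrderOf_dvd_of_nsmul_eq_zero hs)
    refine (ha.2.2 _ ?_ (isMinZeroSum_replicate (by omega) hh).1
      (isMinZeroSum_replicate (by omega) hh).2.1).symm
    rw [hr]
    exact (Multiset.replicate_le_replicate h).2 hle
  by_cases h1 : g ∈ a
  · by_cases h2 : -g ∈ a
    · refine Or.inl (ha.2.2 {g, -g} ?_ (by simp) (by simp)).symm
      refine (Multiset.le_iff_subset (by simp [hgg])).2 ?_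
      intro x hx
      simp only [Multiset.insert_eq_cons, Multiset.mem_cons, Multiset.mem_singleton] at hx
      rcases hx with rfl | rfl <;> assumption
    · refine Or.inr (Or.inl (key g hg fun e he => ?_))
      rcases hmem e he with rfl | rfl | rfl
      exacts [absurd he h0, rfl, absurd he h2]
  · refine Or.inr (Or.inr (key (-g) (by rw [addOrderOf_neg, hg]) fun e he => ?_))
    rcases hmem e he with rfl | rfl | rfl
    exacts [absurd he h0, absurd he h1, rfl]

/-- Here `j`, `u`, `v` count the atoms `g (-g)`, `gⁿ`, `(-g)ⁿ`; each `0` is an atom by itself. -/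
theorem exists_card_eq_of_forall_mem [DecidableEq G] {g : G} (hn : 3 ≤ n)
    (hg : addOrderOf g = n) {s : Multiset G} {z : Multiset (Multiset G)}
    (hz : IsFactorization s z) (hmem : ∀ e ∈ s, e = 0 ∨ e = g ∨ e = -g) :
    ∃ j u v, z.card = s.count 0 + j + u + v ∧ s.count g = j + n * u ∧
      s.count (-g) = j + n * v := by
  have hgg := ne_neg_of_addOrderOf_eq hn hg
  have hg0 : g ≠ 0 := by
    rintro rfl
    rw [addOrderOf_zero] at hg
    omega
  obtain ⟨hz, rfl⟩ := hz
  induction z using Multiset.induction_on with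
  | empty => exact ⟨0, 0, 0, by simp⟩
  | cons a z ih =>
    rw [Multiset.sum_cons] at hmem
    obtain ⟨j, u, v, h1, h2, h3⟩ := ih (fun b hb => hz b (Multiset.mem_cons_of_mem hb))
      fun e he => hmem e (Multiset.mem_add.2 (Or.inr he))
    simp only [Multiset.card_cons, Multiset.sum_cons, Multiset.count_add, h1, h2, h3]
    rcases (hz a (Multiset.mem_cons_self a z)).eq_of_forall_mem hn hg
      fun e he => hmem e (Multiset.mem_add.2 (Or.inl he)) with rfl | rfl | rfl | rfl
    · refine ⟨j, u, v, ?_, ?_, ?_⟩ <;>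
        simp [hg0]
      omega
    · refine ⟨j + 1, u, v, ?_, ?_, ?_⟩ <;>
        simp [hg0, hg0.symm, hgg, hgg.symm] <;>
        omega
    · refine ⟨j, u + 1, v, ?_, ?_, ?_⟩ <;>
        simp [Multiset.count_replicate, hg0, hgg, mul_add] <;> omega
    · refine ⟨j, u, v + 1, ?_, ?_, ?_⟩ <;>
        simp [Multiset.count_replicate, hg0, hgg.symm, mul_add] <;> omega

theorem dvd_card_sub_card {g : G} (hn : 3 ≤ n)
    (hg : addOrderOf g = n) {s : Multiset G} {z z' : Multiset (Multiset G)}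
    (hz : IsFactorization s z) (hz' : IsFactorization s z')
    (hmem : ∀ e ∈ s, e = 0 ∨ e = g ∨ e = -g) :
    ((n : ℤ) - 2) ∣ (z'.card : ℤ) - z.card := by
  classical
  obtain ⟨j, u, v, h1, h2, h3⟩ := exists_card_eq_of_forall_mem hn hg hz hmem
  obtain ⟨j', u', v', h1', h2', h3'⟩ := exists_card_eq_of_forall_mem hn hg hz' hmem
  rw [h2] at h2'
  rw [h3] at h3'
  have h4 : (n : ℤ) * (u' - u) = n * (v' - v) := by
    have e1 : (j : ℤ) + n * u = j' + n * u' := by exact_mod_cast h2'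
    have e2 : (j : ℤ) + n * v = j' + n * v' := by exact_mod_cast h3'
    linarith
  have h5 : (u' : ℤ) - u = v' - v := mul_left_cancel₀ (by omega) h4
  -- The multiplicities of `g` and `-g` force `u' - u = v' - v` and `j' - j = -n (u' - u)`, so the
  -- length changes by `(2 - n)(u' - u)`.
  refine ⟨u - u', ?_⟩
  have e1 : (j : ℤ) + n * u = j' + n * u' := by exact_mod_cast h2'
  rw [h1, h1']
  push_cast
  linarith

/-! ### Locating the exchange that crosses the gap. -/

/-- The lengths of the factorizations of `s` into minimal zero-sum sequences. -/
def zeroSumLengths (s : Multiset G) : Set ℕ := {k | ∃ z, IsFactorization s z ∧ z.card = k}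

/-- If `U₁ U₂ = V₁ ⋯ Vₙ` with atoms over a group of order `n`, then `U₁ = gⁿ` and
`U₂ = (-g)ⁿ`. -/
theorem eq_pair_of_card [Finite G] (hn : 3 ≤ n) (hcard : Nat.card G = n)
    {p q : Multiset (Multiset G)} (hp : ∀ a ∈ p, IsMinZeroSum a) (hq : ∀ a ∈ q, IsMinZeroSum a)
    (hpq : p.sum = q.sum) (hpc : p.card = 2) (hqc : q.card = n) :
    ∃ g : G, addOrderOf g = n ∧ p = {Multiset.replicate n g, Multiset.replicate n (-g)} := by
  obtain ⟨a, b, rfl⟩ := Multiset.card_eq_two.1 hpc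
  have ha := hp a (by simp)
  have hb := hp b (by simp)
  rw [Multiset.insert_eq_cons, Multiset.sum_cons, Multiset.sum_singleton] at hpq
  have hac := ha.card_le
  have hbc := hb.card_le
  rw [hcard] at hac hbc
  -- If `0` occurred in `a`, then `a = {0}` would be an atom of `q` too. Cancelling it leaves the
  -- single atom `b`, so `q` would have at most two atoms.
  have hzero : ∀ a b : Multiset G, IsMinZeroSum a → IsMinZeroSum b → a + b = q.sum →
      (0 : G) ∉ a := by
    intro a b ha hb hab h0
    have haz : {0} = a := ha.2.2 {0} (Multiset.singleton_le.2 h0) (by simp) (by simp)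
    have h1 : (0 : G) ∈ q.sum := by
      rw [← hab]
      exact Multiset.mem_add.2 (Or.inl h0)
    obtain ⟨c, hc, h0c⟩ : ∃ c ∈ q, (0 : G) ∈ c := Multiset.mem_join.1 h1
    have hcz : {0} = c := (hq c hc).2.2 {0} (Multiset.singleton_le.2 h0c) (by simp) (by simp)
    obtain ⟨r, rfl⟩ := Multiset.exists_cons_of_mem hc
    rw [Multiset.sum_cons, ← hcz, ← haz] at hab
    have hbr : b = r.sum := add_left_cancel hab
    have hr : r.card ≤ 1 := by
      obtain ⟨x, hx⟩ := Multiset.exists_mem_of_ne_zero hb.1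
      obtain ⟨t, rfl⟩ := Multiset.exists_cons_of_mem hx
      have := card_le_card_of_sum_eq_add (f := t) (r := {x}) (z := r)
        ⟨fun d hd => hq d (Multiset.mem_cons_of_mem hd), by rw [← hbr, Multiset.singleton_add]⟩
        (hb.isZeroSumFree (Multiset.lt_cons_self t x))
      rwa [Multiset.card_singleton] at this
    rw [Multiset.card_cons] at hqc
    omega
  have h0a := hzero a b ha hb hpq
  have h0b := hzero b a hb ha (by rw [add_comm, hpq])
  have h2 : ∀ v ∈ q, 2 ≤ v.card := by
    intro v hv
    by_contra! hlt
    have hpos := (hq v hv).card_pos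
    obtain ⟨x, rfl⟩ := Multiset.card_eq_one.1 (show v.card = 1 by omega)
    have hx := (hq _ hv).2.1
    rw [Multiset.sum_singleton] at hx
    subst hx
    have h1 : (0 : G) ∈ q.sum := Multiset.mem_join.2 ⟨_, hv, Multiset.mem_singleton_self _⟩
    rw [← hpq, Multiset.mem_add] at h1
    exact h1.elim h0a h0b
  -- Hence `2 n ≤ |a| + |b| ≤ 2 n`: both atoms have length `n`, and every atom of `q` has length
  -- `2`.
  have hle := card_mul_le_card_sum 2 q h2
  have hsumc := congrArg Multiset.card hpq
  rw [Multiset.card_add] at hsumc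
  obtain ⟨g, hag, hg⟩ := ha.exists_eq_replicate (by omega) (by omega)
  obtain ⟨h, hbh, hh⟩ := hb.exists_eq_replicate (by omega) (by omega)
  rw [hcard] at hag hbh hg hh
  suffices h = -g by
    subst this
    exact ⟨g, hg, by rw [hag, hbh]⟩
  obtain ⟨v, hv⟩ := Multiset.exists_mem_of_ne_zero (s := q) (by rintro rfl; simp at hqc; omega)
  have hv2 : v.card = 2 := by
    have h1 := h2 v hv
    obtain ⟨r, rfl⟩ := Multiset.exists_cons_of_mem hv
    have h3 := card_mul_le_card_sum 2 r fun d hd => h2 d (Multiset.mem_cons_of_mem hd)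
    rw [Multiset.sum_cons, Multiset.card_add] at hsumc
    rw [Multiset.card_cons] at hqc
    omega
  obtain ⟨x, y, rfl⟩ := Multiset.card_eq_two.1 hv2
  have hxy := (hq _ hv).2.1
  rw [Multiset.insert_eq_cons, Multiset.sum_cons, Multiset.sum_singleton] at hxy
  have hmem : ∀ x ∈ q.sum, x = g ∨ x = h := by
    intro x hx
    rw [← hpq, hag, hbh, Multiset.mem_add] at hx
    exact hx.imp Multiset.eq_of_mem_replicate Multiset.eq_of_mem_replicate
  have hx := hmem x (Multiset.mem_join.2 ⟨_, hv, by simp⟩)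
  have hy := hmem y (Multiset.mem_join.2 ⟨_, hv, by simp⟩)
  rcases hx with rfl | rfl <;> rcases hy with rfl | rfl
  · exact absurd (eq_neg_of_add_eq_zero_left hxy) (ne_neg_of_addOrderOf_eq hn hg)
  · exact eq_neg_of_add_eq_zero_right hxy
  · exact eq_neg_of_add_eq_zero_left hxy
  · exact absurd (eq_neg_of_add_eq_zero_left hxy) (ne_neg_of_addOrderOf_eq hn hh)

/-- A gap of length at least `n - 2` in the set of lengths comes from replacing two atoms by
`n` atoms. -/
theorem exists_of_large_gap [Finite G] (hn : 3 ≤ n) (hcard : Nat.card G = n) {s : Multiset G}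
    {k l : ℕ} (hk : k ∈ zeroSumLengths s) (hl : l ∈ zeroSumLengths s)
    (hgap : ∀ m ∈ zeroSumLengths s, ¬ (k < m ∧ m < l)) (hkl : k + (n - 2) ≤ l) :
    l = k + (n - 2) ∧ ∃ g : G, addOrderOf g = n ∧ ∀ e ∈ s, e = 0 ∨ e = g ∨ e = -g := by
  obtain ⟨z, hz, rfl⟩ := hk
  obtain ⟨z', hz', rfl⟩ := hl
  have hgap' : ∀ y, IsFactorization s y → ¬ (z.card < y.card ∧ y.card < z'.card) :=
    fun y hy => hgap _ ⟨y, hy, rfl⟩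
  obtain ⟨y, y', hy, hstep, h1, h2⟩ := exists_step_of_gap hz
    (reflTransGen_step (n := n) (fun a ha => hcard ▸ ha.card_le) s z z' hz hz') hgap' le_rfl le_rfl
    (by omega)
  obtain ⟨c, p, q, rfl, rfl, hp, hq, hpq, hpn, hqn⟩ := hstep
  rw [Multiset.card_add] at h1 h2
  -- A product of at most one atom has no longer factorization, but the step gains length.
  have hp2 : 2 ≤ p.card := by
    by_contra! hlt
    have hq1 : q.card ≤ p.card := by
      rcases Nat.lt_or_ge 0 p.card with h | h
      · obtain ⟨a, rfl⟩ := Multiset.card_eq_one.1 (show p.card = 1 by omega)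
        have ha := hp a (Multiset.mem_singleton_self a)
        obtain ⟨x, hx⟩ := Multiset.exists_mem_of_ne_zero ha.1
        obtain ⟨t, rfl⟩ := Multiset.exists_cons_of_mem hx
        rw [Multiset.sum_singleton] at hpq
        exact card_le_card_of_sum_eq_add (f := t) (r := {x}) (z := q)
          ⟨hq, by rw [← hpq, Multiset.singleton_add]⟩
          (ha.isZeroSumFree (Multiset.lt_cons_self t x))
      · obtain rfl := Multiset.card_eq_zero.1 (show p.card = 0 by omega)
        rw [Multiset.sum_zero] at hpq
        have : IsFactorization 0 q := ⟨hq, hpq.symm⟩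
        rw [this.eq_zero_iff.2 rfl]
    omega
  refine ⟨by omega, ?_⟩
  obtain ⟨g, hg, rfl⟩ := eq_pair_of_card hn hcard hp hq hpq (by omega) (by omega)
  refine ⟨g, hg, fun e he => eq_of_mem_of_gap hn hcard hg hy (fun w hw hlt => ?_) he⟩
  exact hgap' w hw ⟨by omega, by omega⟩

/-- The given gap confines the terms of `s` to `{0, g, -g}`. Any other gap is then a positive
multiple of `n - 2`, and `exists_of_large_gap` excludes larger multiples. -/
theorem gap_eq_of_gap_eq [Finite G] (hn : 3 ≤ n) (hcard : Nat.card G = n) {s : Multiset G}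
    {k l k' l' : ℕ} (hk : k ∈ zeroSumLengths s) (hl : l ∈ zeroSumLengths s)
    (hgap : ∀ m ∈ zeroSumLengths s, ¬ (k < m ∧ m < l)) (hkl : l = k + (n - 2))
    (hk' : k' ∈ zeroSumLengths s) (hl' : l' ∈ zeroSumLengths s)
    (hgap' : ∀ m ∈ zeroSumLengths s, ¬ (k' < m ∧ m < l')) (hkl' : k' < l') :
    l' = k' + (n - 2) := by
  obtain ⟨-, g, hg, hmem⟩ := exists_of_large_gap hn hcard hk hl hgap hkl.ge
  refine (exists_of_large_gap hn hcard hk' hl' hgap' ?_).1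
  obtain ⟨z, hz, rfl⟩ := hk'
  obtain ⟨z', hz', rfl⟩ := hl'
  have := Int.le_of_dvd (by omega) (dvd_card_sub_card hn hg hz hz' hmem)
  omega

end Gap

/-! ### Transfer from the Krull monoid to zero-sum sequences. -/

theorem exists_add_of_map_eq_add {α β : Type*} (f : α → β) {s : Multiset α} {t u : Multiset β}
    (h : s.map f = t + u) : ∃ s₁ s₂, s = s₁ + s₂ ∧ s₁.map f = t ∧ s₂.map f = u := by
  induction t using Multiset.induction_on generalizing s with
  | empty => exact ⟨0, s, by simp, by simp, by simpa using h⟩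
  | cons b t ih =>
    have hb : b ∈ s.map f := by
      rw [h]
      simp
    obtain ⟨x, hx, rfl⟩ := Multiset.mem_map.1 hb
    obtain ⟨s', rfl⟩ := Multiset.exists_cons_of_mem hx
    rw [Multiset.map_cons, Multiset.cons_add, Multiset.cons_inj_right] at h
    obtain ⟨s₁, s₂, rfl, rfl, rfl⟩ := ih h
    exact ⟨x ::ₘ s₁, s₂, by simp, by simp, rfl⟩

namespace DivisorTheory

variable {M : Type*} [CancelCommMonoid M] {P : Type*} (T : DivisorTheory M P)

/-- The class of a prime divisor, in additive notation. -/
def primeClass (p : P) : Additive T.ClassGroup :=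
  Additive.ofMul (T.con.mk' (Multiplicative.ofAdd {p}))

/-- The block of an element: the sequence of the classes of its prime divisors. -/
def block (a : M) : Multiset (Additive T.ClassGroup) :=
  (Multiplicative.toAdd (T.φ a)).map T.primeClass

theorem sum_map_primeClass (s : Multiset P) :
    (s.map T.primeClass).sum = Additive.ofMul (T.con.mk' (Multiplicative.ofAdd s)) := by
  induction s using Multiset.induction_on with
  | empty =>
    rw [Multiset.map_zero, Multiset.sum_zero, ofAdd_zero, map_one]
    rfl
  | cons p s ih =>
    rw [Multiset.map_cons, Multiset.sum_cons, ih, ← Multiset.singleton_add, ofAdd_add, map_mul]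
    rfl

/-- A trivial class only gives `s φ(a) = φ(b)`; since `φ` reflects divisibility, `a ∣ b`, and the
quotient is the required preimage. -/
theorem sum_map_primeClass_eq_zero_iff (s : Multiset P) :
    (s.map T.primeClass).sum = 0 ↔ ∃ a, T.φ a = Multiplicative.ofAdd s := by
  rw [sum_map_primeClass]
  have h : Additive.ofMul (T.con.mk' (Multiplicative.ofAdd s)) = (0 : Additive T.ClassGroup) ↔
      T.con (Multiplicative.ofAdd s) 1 := Con.eq T.con
  refine h.trans ⟨?_, ?_⟩
  · rintro ⟨a, b, hab⟩
    rw [one_mul] at hab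
    obtain ⟨c, rfl⟩ := T.dvd_of_map_dvd a b ⟨_, hab.symm.trans (mul_comm _ _)⟩
    refine ⟨c, ?_⟩
    rw [map_mul, mul_comm] at hab
    exact (mul_left_cancel hab).symm
  · rintro ⟨a, ha⟩
    exact ⟨1, a, by rw [map_one, mul_one, one_mul, ha]⟩

theorem block_mul (a b : M) : T.block (a * b) = T.block a + T.block b := by
  rw [block, map_mul, toAdd_mul, Multiset.map_add]
  rfl

theorem sum_block (a : M) : (T.block a).sum = 0 :=
  (T.sum_map_primeClass_eq_zero_iff _).2 ⟨a, rfl⟩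

theorem block_eq_zero_iff {a : M} : T.block a = 0 ↔ IsUnit a := by
  constructor
  · intro h
    rw [block, Multiset.map_eq_zero] at h
    have h1 : T.φ a = 1 := h
    exact isUnit_of_dvd_one (T.dvd_of_map_dvd a 1 (by rw [h1]; exact one_dvd _))
  · rintro ⟨u, rfl⟩
    have h := T.block_mul u (u⁻¹ : Mˣ)
    rw [Units.mul_inv] at h
    have h1 : T.block 1 = 0 := by rw [block, map_one, toAdd_one, Multiset.map_zero]
    rw [h1] at h
    exact (add_eq_zero.1 h.symm).1

/-- Decompositions of the block of `x` into zero-sum sequences lift to factorizations of `x`. -/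
theorem exists_mul_of_block_eq_add {x : M} {t u : Multiset (Additive T.ClassGroup)}
    (h : T.block x = t + u) (ht : t.sum = 0) :
    ∃ a b, x = a * b ∧ T.block a = t ∧ T.block b = u := by
  obtain ⟨s₁, s₂, hs, rfl, rfl⟩ := exists_add_of_map_eq_add _ h
  obtain ⟨a, ha⟩ := (T.sum_map_primeClass_eq_zero_iff s₁).1 ht
  have hx : T.φ x = T.φ a * Multiplicative.ofAdd s₂ := by
    rw [ha, ← ofAdd_add, ← hs, ofAdd_toAdd]
  obtain ⟨b, rfl⟩ := T.dvd_of_map_dvd a x ⟨_, hx⟩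
  rw [map_mul] at hx
  refine ⟨a, b, rfl, ?_, ?_⟩
  · rw [block, ha, toAdd_ofAdd]
  · rw [block, mul_left_cancel hx, toAdd_ofAdd]

theorem irreducible_iff {a : M} : Irreducible a ↔ IsMinZeroSum (T.block a) := by
  rw [_root_.irreducible_iff]
  constructor
  · rintro ⟨h1, h2⟩
    refine ⟨fun h => h1 (T.block_eq_zero_iff.1 h), T.sum_block a, fun t ht ht0 hts => ?_⟩
    obtain ⟨u, hu⟩ := Multiset.le_iff_exists_add.1 ht
    obtain ⟨b, c, rfl, rfl, rfl⟩ := T.exists_mul_of_block_eq_add hu hts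
    rcases h2 rfl with h | h
    · exact absurd (T.block_eq_zero_iff.2 h) ht0
    · rw [hu, T.block_eq_zero_iff.2 h, add_zero]
  · rintro ⟨h1, -, h2⟩
    refine ⟨fun h => h1 (T.block_eq_zero_iff.2 h), ?_⟩
    rintro b c rfl
    rw [T.block_mul] at h2
    by_cases hb : T.block b = 0
    · exact Or.inl (T.block_eq_zero_iff.1 hb)
    · have := h2 (T.block b) (Multiset.le_add_right _ _) hb (T.sum_block b)
      exact Or.inr (T.block_eq_zero_iff.1 (left_eq_add.1 this))

theorem block_prod (s : Multiset M) : T.block s.prod = (s.map T.block).sum := by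
  induction s using Multiset.induction_on with
  | empty => simp [T.block_eq_zero_iff]
  | cons a s ih => rw [Multiset.prod_cons, T.block_mul, ih, Multiset.map_cons, Multiset.sum_cons]

theorem exists_multiset_of_isFactorization {x : M}
    {z : Multiset (Multiset (Additive T.ClassGroup))} (hz : IsFactorization (T.block x) z)
    (hx : ¬ IsUnit x) :
    ∃ s : Multiset M, (∀ a ∈ s, Irreducible a) ∧ s.prod = x ∧ s.card = z.card := by
  obtain ⟨hz, hsum⟩ := hz
  induction z using Multiset.induction_on generalizing x with
  | empty => exact absurd (T.block_eq_zero_iff.1 (by simpa using hsum.symm)) hx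
  | cons a z ih =>
    have ha := hz a (Multiset.mem_cons_self a z)
    rw [Multiset.sum_cons] at hsum
    obtain ⟨b, c, rfl, rfl, hc⟩ := T.exists_mul_of_block_eq_add hsum.symm ha.2.1
    -- A unit cofactor is absorbed into the last atom. This needs `x` to be a nonunit: a unit other
    -- than `1` is not a product of atoms, although its block is empty.
    by_cases hcu : IsUnit c
    · have hz0 : z = 0 := (IsFactorization.eq_zero_iff
        ⟨fun d hd => hz d (Multiset.mem_cons_of_mem hd), rfl⟩).2
        (by rw [← hc, T.block_eq_zero_iff.2 hcu])
      refine ⟨{b * c}, fun d hd => ?_, by simp, by simp [hz0]⟩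
      rw [Multiset.mem_singleton.1 hd, T.irreducible_iff, T.block_mul,
        T.block_eq_zero_iff.2 hcu, add_zero]
      exact ha
    · obtain ⟨s, hs, rfl, hcard⟩ := ih hcu (fun d hd => hz d (Multiset.mem_cons_of_mem hd)) hc.symm
      refine ⟨b ::ₘ s, fun d hd => ?_, by simp, by simp [hcard]⟩
      rcases Multiset.mem_cons.1 hd with rfl | hd
      exacts [T.irreducible_iff.2 ha, hs d hd]

/-- The block homomorphism preserves sets of lengths. -/
theorem setOfLengths_eq {x : M} (hx : ¬ IsUnit x) :
    setOfLengths x = zeroSumLengths (T.block x) := by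
  ext k
  constructor
  · rintro ⟨s, hs, rfl, rfl⟩
    refine ⟨s.map T.block, ⟨fun a ha => ?_, (T.block_prod s).symm⟩, Multiset.card_map _ _⟩
    obtain ⟨b, hb, rfl⟩ := Multiset.mem_map.1 ha
    exact T.irreducible_iff.1 (hs b hb)
  · rintro ⟨z, hz, rfl⟩
    exact T.exists_multiset_of_isFactorization hz hx

end DivisorTheory

theorem not_isUnit_of_mem_setOfLengths {M : Type*} [CommMonoid M] {x : M} {l : ℕ}
    (hl : l ∈ setOfLengths x) (hpos : 0 < l) : ¬ IsUnit x := by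
  obtain ⟨s, hs, rfl, rfl⟩ := hl
  obtain ⟨a, ha⟩ := Multiset.card_pos_iff_exists_mem.1 hpos
  exact fun h => (hs a ha).not_isUnit (isUnit_of_dvd_unit (Multiset.dvd_prod ha) h)

end KrullMonoid

open KrullMonoid in
theorem theorem3p2 {M : Type*} [CancelCommMonoid M] {P : Type*}
    (T : KrullMonoid.DivisorTheory M P) (n : ℕ) (hn : 3 ≤ n)
    (hcyc : IsCyclic T.ClassGroup) (hcard : Nat.card T.ClassGroup = n)
    (x : M) (hx : n - 2 ∈ KrullMonoid.deltaSet x) :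
    KrullMonoid.deltaSet x = {n - 2} := by
  have hcard' : Nat.card (Additive T.ClassGroup) = n := hcard
  -- `Nat.card` is `0` on infinite types, so `n ≥ 3` gives finiteness.
  have : Finite (Additive T.ClassGroup) := Nat.finite_of_card_ne_zero (by omega)
  refine Set.eq_singleton_iff_unique_mem.2 ⟨hx, ?_⟩
  obtain ⟨k, hk, l, hl, hkl, hgap, hd⟩ := hx
  rintro d ⟨k', hk', l', hl', hkl', hgap', rfl⟩
  have hxu := not_isUnit_of_mem_setOfLengths hl (Nat.zero_lt_of_lt hkl)
  rw [T.setOfLengths_eq hxu] at hk hl hgap hk' hl' hgap'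
  have := gap_eq_of_gap_eq hn hcard' hk hl hgap (by omega) hk' hl' hgap' hkl'
  omega
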